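/- Let Alice's and Bob's Hilbert spaces be graded by local particle number, $\mathcal H^A=\bigoplus_{n\ge0}\mathcal H^A_n$ and $\mathcal H^B=\bigoplus_{m\ge0}\mathcal H^B_m$, with every $\mathcal H^A_n$, $\mathcal H^B_m$ finite-dimensional. Fix $N\ge 0$ and let $\phi$ and $\psi_i$ ($i$ in a finite set) be unit vectors with total particle number $N$, so that $\phi=\phi^0\oplus\dots\oplus\phi^N$ and $\psi_i=\psi_i^0\oplus\dots\oplus\psi_i^N$ with $\phi^n,\psi_i^n\in\mathcal H^A_n\otimes\mathcal H^B_{N-n}$. Let $p_i\ge0$ with $\sum_ip_i=1$. Let $\lambda^n$ and $\mu_i^n$ be the decreasingly ordered vectors of Schmidt coefficients (squared Schmidt amplitudes, i.e. eigenvalues of the reduced operator on $\mathcal H^A_n$, zeros included) of the unnormalised vectors $\phi^n$ and $\psi_i^n$. An LOCC conversion $\phi\to\{(p_i,\psi_i)\}$ is a finite adaptive protocol in which, in each round, Alice or Bob performs a generalised measurement on their own system, with finitely many Kraus operators $M_j$, $\sum_jM_j^\dagger M_j=1$, and communicates the result; every final branch is assigned to an outcome $i$, the (unnormalised) final vector of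 each branch assigned to $i$ is a multiple of $\psi_i$, and the total probability of the branches assigned to $i$ is $p_i$. The conversion is SSR-compatible if all Kraus operators commute with the local particle number operator, i.e. are block-diagonal, $M=\bigoplus_nM^n$. For decreasing $v,w\in\mathbb R^d$, $v\prec w$ means $\sum_{k\le e}v_k\le\sum_{k\le e}w_k$ for all $1\le e<d$, with equality for $e=d$. Then the following are equivalent: 1. there is an SSR-compatible LOCC conversion $\phi\to\{(p_i,\psi_i)\}$; 2. $\lambda^n\prec\sum_ip_i\,\mu_i^n$ for every $n=0,\dots,N$; 3. for every $n=0,\dots,N$ with $\phi^n\ne0$ there is an LOCC conversion (without superselection rule, on $\mathcal H^A_n\otimes\mathcal H^B_{N-n}$) $\hat\phi^n\to\{(p_i'^{\,n},\hat\psi_i^n)\}$, where $p_i'^{\,n}=p_i\,\|\psi_i^n\|^2/\|\phi^n\|^2$ and a hat denotes normalisation (if $\psi_i^n=0$, then $p_i'^{\,n}=0$ and outcome $i$ does not occur). -/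

import Mathlib

open scoped BigOperators Matrix

noncomputable section

namespace SSR

/-! ### Adaptive local protocols -/

/-- A finite adaptive LOCC protocol. `R` and `S` are the algebras of admissible local operators of
Alice and Bob. In each round one party performs a generalized measurement, given by Kraus operators
satisfying the completeness relation `∑ j, M_j† M_j = 1`, and announces the outcome `j`; everything
that follows may depend on it. A finished branch is declared to be outcome `i`. -/
inductive Protocol (R S : Type*) [Ring R] [StarRing R] [Ring S] [StarRing S] (ι : Type*)
  | done (i : ι) : Protocol R S ι
  | alice (k : ℕ) (M : Fin k → R) (hM : ∑ j, star (M j) * M j = 1)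
      (next : Fin k → Protocol R S ι) : Protocol R S ι
  | bob (k : ℕ) (M : Fin k → S) (hM : ∑ j, star (M j) * M j = 1)
      (next : Fin k → Protocol R S ι) : Protocol R S ι

section Protocol

variable {R S : Type*} [Ring R] [StarRing R] [Ring S] [StarRing S] {ι V : Type*}

/-- Running the protocol on the (unnormalized) vector `χ`, every branch that is declared to be
outcome `i` ends in the pure state `ψ i`, i.e. in a scalar multiple of that vector. Here `actA` and
`actB` are the actions `M ↦ M ⊗ 1` and `M ↦ 1 ⊗ M` on the bipartite space `V`. -/
def Protocol.Yields [SMul ℂ V] (actA : R → V → V) (actB : S → V → V) (ψ : ι → V) :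
    Protocol R S ι → V → Prop
  | .done i, χ => ∃ c : ℂ, χ = c • ψ i
  | .alice k M _ next, χ => ∀ j : Fin k, (next j).Yields actA actB ψ (actA (M j) χ)
  | .bob k M _ next, χ => ∀ j : Fin k, (next j).Yields actA actB ψ (actB (M j) χ)

open Classical in
/-- Total probability of the branches declared to be outcome `i`; the probability of a branch
is the squared norm of its unnormalized final vector. -/
def Protocol.prob (actA : R → V → V) (actB : S → V → V) (normSq : V → ℝ) (i : ι) :
    Protocol R S ι → V → ℝ
  | .done i', χ => if i' = i then normSq χ else 0
  | .alice k M _ next, χ => ∑ j : Fin k, (next j).prob actA actB normSq i (actA (M j) χ)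
  | .bob k M _ next, χ => ∑ j : Fin k, (next j).prob actA actB normSq i (actB (M j) χ)

end Protocol

/-! ### Ordinary bipartite systems

Vectors of `ℂ^α ⊗ ℂ^β` are written as coefficient matrices `x = ∑ x a b |a⟩|b⟩`. -/

section Plain

variable {α β ι : Type*} [Fintype α] [DecidableEq α] [Fintype β] [DecidableEq β]

/-- `⟨x|x⟩`. -/
def normSq (x : Matrix α β ℂ) : ℝ := ∑ a, ∑ b, ‖x a b‖ ^ 2

/-- `x / √⟨x|x⟩` (and `0` for `x = 0`). -/
def normalize (x : Matrix α β ℂ) : Matrix α β ℂ := (((Real.sqrt (normSq x))⁻¹ : ℝ) : ℂ) • x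

/-- `(M ⊗ 1) x`. -/
def actA (M : Matrix α α ℂ) (x : Matrix α β ℂ) : Matrix α β ℂ := M * x

/-- `(1 ⊗ M) x`. -/
def actB (M : Matrix β β ℂ) (x : Matrix α β ℂ) : Matrix α β ℂ := x * Mᵀ

/-- The decreasingly ordered Schmidt coefficients of `x` (squares of the Schmidt amplitudes, so
that they sum up to `⟨x|x⟩`), padded with zeros to length `dim ℂ^α`: the eigenvalues of the
reduced operator `tr_B |x⟩⟨x| = x x†`. -/
def schmidtVector (x : Matrix α β ℂ) : Fin (Fintype.card α) → ℝ :=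
  (Matrix.isHermitian_mul_conjTranspose_self x).eigenvalues₀

/-- LOCC conversion `φ ⟶ {(p i, ψ i)}` without superselection rule. -/
def LOCCConverts (φ : Matrix α β ℂ) (p : ι → ℝ) (ψ : ι → Matrix α β ℂ) : Prop :=
  ∃ P : Protocol (Matrix α α ℂ) (Matrix β β ℂ) ι,
    P.Yields actA actB ψ φ ∧ ∀ i, P.prob actA actB normSq i φ = p i

end Plain

/-- Majorization `v ≺ w` of decreasingly ordered vectors: partial sums of `v` are bounded by those
of `w`, with equality for the full sums. -/
def MajorizedBy {d : ℕ} (v w : Fin d → ℝ) : Prop :=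
  (∀ k < d, ∑ j with j.val < k, v j ≤ ∑ j with j.val < k, w j) ∧ ∑ j, v j = ∑ j, w j

/-! ### Systems with particle number superselection rule

`A n` indexes an orthonormal basis of the `n`-particle space of Alice, so that her Hilbert space is
`⨁ n, ℂ^(A n)`; likewise `B m` for Bob. -/

/-- Local operators commuting with the local particle number operator, i.e. `O = ⨁ n, O n` with
`O n` acting on the `n`-particle space. -/
abbrev LocalOp (A : ℕ → Type*) := ∀ n, Matrix (A n) (A n) ℂ

/-- Vectors with total particle number `N`: `φ = φ⁰ ⊕ ⋯ ⊕ φᴺ`, where `φⁿ` lies in the tensor product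
of the `n`-particle space of Alice and the `(N - n)`-particle space of Bob. -/
abbrev State (A B : ℕ → Type*) (N : ℕ) := ∀ n : Fin (N + 1), Matrix (A n) (B (N - n)) ℂ

section Graded

variable {A B : ℕ → Type*} [∀ n, Fintype (A n)] [∀ n, DecidableEq (A n)]
  [∀ n, Fintype (B n)] [∀ n, DecidableEq (B n)] {N : ℕ} {ι : Type*}

/-- `⟨φ|φ⟩`. -/
def State.normSq (φ : State A B N) : ℝ := ∑ n, SSR.normSq (φ n)

/-- `(M ⊗ 1) φ` for `M = ⨁ n, M n`. -/
def State.actA (M : LocalOp A) (φ : State A B N) : State A B N := fun n => SSR.actA (M n) (φ n)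

/-- `(1 ⊗ M) φ` for `M = ⨁ m, M m`; on the component `φⁿ` Bob has `N - n` particles. -/
def State.actB (M : LocalOp B) (φ : State A B N) : State A B N :=
  fun n => SSR.actB (M (N - n)) (φ n)

/-- LOCC conversion `φ ⟶ {(p i, ψ i)}` in which all local operators respect the superselection
rule. -/
def SSRConverts (φ : State A B N) (p : ι → ℝ) (ψ : ι → State A B N) : Prop :=
  ∃ P : Protocol (LocalOp A) (LocalOp B) ι,
    P.Yields State.actA State.actB ψ φ ∧
      ∀ i, P.prob State.actA State.actB State.normSq i φ = p i

/-- The SSR-ordered Schmidt vector `(λ⁰, …, λᴺ)`: the ordered Schmidt coefficients of the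
unnormalized components `φⁿ`. -/
def ssrSchmidtVector (φ : State A B N) (n : Fin (N + 1)) : Fin (Fintype.card (A n)) → ℝ :=
  schmidtVector (φ n)

end Graded

end SSR

end

/-!
A protocol obeying the superselection rule acts on every sector separately and so restricts to an
ordinary protocol on each of them. The tails of the Schmidt vector of `x` are the squared distances
from `x` to the vectors of bounded Schmidt rank; since a local measurement does not raise the
Schmidt rank, the tails cannot grow on average, which is the majorization relation in each sector.
In a sector with `φⁿ = 0` no protocol is given, but there all `p i • ψ i n` vanish too, because the
total norms of `φ` and of the ensemble agree.

Conversely, by majorization `λⁿ` is a convex combination of permutations of `∑ i, p i • μ i n`, and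
the weights can be chosen independently of `n`: the convex hull of a product is the product of the
convex hulls. The reduced operator of `φⁿ` is then a mixture, with weights not depending on `n`, of
unitary conjugates of those of the `ψ i n`. Bob steers `φ` to the corresponding purifications by a
measurement and Alice undoes the unitaries, simultaneously in all sectors.
-/

namespace SSR

section Majorization

lemma sum_filter_val_lt {M : Type*} [AddCommMonoid M] {d k : ℕ} (hk : k ≤ d) (g : ℕ → M) :
    ∑ j : Fin d with j.val < k, g j = ∑ j ∈ Finset.range k, g j := by
  rw [Finset.sum_filter, Fin.sum_univ_eq_sum_range (fun j => if j < k then g j else 0) d,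
    ← Finset.sum_filter, Finset.range_eq_Ico, Finset.range_eq_Ico, Finset.Ico_filter_lt,
    min_eq_right hk]

lemma sum_range_mul_nonneg_of_antitone {d : ℕ} {c g : ℕ → ℝ}
    (hc : ∀ j, j + 1 < d → c (j + 1) ≤ c j) (hg : ∀ k < d, 0 ≤ ∑ j ∈ Finset.range k, g j)
    (hd : ∑ j ∈ Finset.range d, g j = 0) :
    0 ≤ ∑ j ∈ Finset.range d, c j * g j := by
  have hparts := Finset.sum_range_by_parts c g d
  simp only [smul_eq_mul, hd, mul_zero, zero_sub] at hparts
  rw [hparts, ← Finset.sum_neg_distrib]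
  refine Finset.sum_nonneg fun j hj => ?_
  have hjd : j + 1 < d := by
    rw [Finset.mem_range] at hj
    omega
  rw [← neg_mul, neg_sub]
  exact mul_nonneg (sub_nonneg.mpr (hc j hjd)) (hg _ hjd)

namespace MajorizedBy

variable {d : ℕ} {v w : Fin d → ℝ}

lemma smul {a : ℝ} (ha : 0 ≤ a) (h : MajorizedBy v w) : MajorizedBy (a • v) (a • w) := by
  simp only [MajorizedBy, Pi.smul_apply, smul_eq_mul, ← Finset.mul_sum]
  exact ⟨fun k hk => mul_le_mul_of_nonneg_left (h.1 k hk) ha, by rw [h.2]⟩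

lemma of_sum_tail_le (hsum : ∑ j, v j = ∑ j, w j)
    (htail : ∀ k : ℕ, ∑ j with k ≤ j.val, w j ≤ ∑ j with k ≤ j.val, v j) :
    MajorizedBy v w := by
  refine ⟨fun k _ => ?_, hsum⟩
  have hsplit (u : Fin d → ℝ) :
      ∑ j with j.val < k, u j + ∑ j with k ≤ j.val, u j = ∑ j, u j := by
    simpa only [not_lt] using Finset.sum_filter_add_sum_filter_not Finset.univ (·.val < k) u
  linarith [hsplit v, hsplit w, htail k]

lemma sum_mul_le {c : Fin d → ℝ} (h : MajorizedBy v w) (hc : Antitone c) :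
    ∑ j, c j * v j ≤ ∑ j, c j * w j := by
  let ext (f : Fin d → ℝ) : ℕ → ℝ := Function.extend Fin.val f 0
  have ext_val (f : Fin d → ℝ) (j : Fin d) : ext f j = f j := Fin.val_injective.extend_apply f 0 j
  have habel : 0 ≤ ∑ j ∈ Finset.range d, ext c j * ext (w - v) j := by
    refine sum_range_mul_nonneg_of_antitone (fun j hj => ?_) (fun k hk => ?_) ?_
    · rw [ext_val c ⟨j + 1, hj⟩, ext_val c ⟨j, by omega⟩]
      exact hc (Fin.mk_le_mk.mpr j.le_succ)
    · simp only [← sum_filter_val_lt hk.le, ext_val, Pi.sub_apply, Finset.sum_sub_distrib,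
        sub_nonneg, h.1 k hk]
    · simp only [← Fin.sum_univ_eq_sum_range, ext_val, Pi.sub_apply, Finset.sum_sub_distrib, h.2,
        sub_self]
  simpa only [← Fin.sum_univ_eq_sum_range (fun j => ext c j * ext (w - v) j), ext_val,
    Pi.sub_apply, mul_sub, Finset.sum_sub_distrib, sub_nonneg] using habel

/-- Rado's theorem, by separation: a functional separating `v` from the rearrangements of `w` would,
by the rearrangement inequality, be violated at the rearrangement sorted like the functional. -/
theorem mem_convexHull_range_perm (h : MajorizedBy v w) (hv : Antitone v) :
    v ∈ convexHull ℝ (Set.range fun σ : Equiv.Perm (Fin d) => w ∘ σ) := by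
  by_contra hmem
  obtain ⟨f, u, hfu, huv⟩ := geometric_hahn_banach_closed_point (convex_convexHull ℝ _)
    ((Set.finite_range _).isClosed_convexHull ℝ) hmem
  obtain ⟨c, hf⟩ : ∃ c : Fin d → ℝ, ∀ x, f x = ∑ j, c j * x j :=
    ⟨_, fun x => (f.toLinearMap.pi_apply_eq_sum_univ x).trans
      (Finset.sum_congr rfl fun _ _ => mul_comm _ _)⟩
  let τ : Equiv.Perm (Fin d) := Tuple.sort (-c)
  have hτ : Antitone (c ∘ τ) := fun i j hij => neg_le_neg_iff.mp (Tuple.monotone_sort (-c) hij)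
  refine lt_irrefl (f v) (lt_trans ?_ huv)
  calc f v = ∑ j, (c ∘ τ) (τ⁻¹ j) * v j := by simp [hf]
    _ ≤ ∑ j, (c ∘ τ) j * v j := (hτ.monovary hv).sum_comp_perm_mul_le_sum_mul
    _ ≤ ∑ j, (c ∘ τ) j * w j := h.sum_mul_le hτ
    _ = f (w ∘ ⇑τ⁻¹) := by
      rw [hf, ← Equiv.sum_comp τ fun j => c j * (w ∘ ⇑τ⁻¹) j]
      simp
    _ < u := hfu _ (subset_convexHull ℝ _ ⟨τ⁻¹, rfl⟩)

end MajorizedBy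

theorem exists_common_weights_of_majorizedBy {m : Type*} [Finite m] {d : m → ℕ}
    {v w : ∀ n, Fin (d n) → ℝ} (h : ∀ n, MajorizedBy (v n) (w n)) (hv : ∀ n, Antitone (v n)) :
    ∃ (κ : Type) (_ : Fintype κ) (t : κ → ℝ) (σ : κ → ∀ n, Equiv.Perm (Fin (d n))),
      (∀ k, 0 ≤ t k) ∧ ∑ k, t k = 1 ∧ ∀ n b, v n b = ∑ k, t k * w n (σ k n b) := by
  have hmem : v ∈ Set.pi Set.univ fun n =>
      convexHull ℝ (Set.range fun σ : Equiv.Perm (Fin (d n)) => w n ∘ σ) :=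
    fun n _ => (h n).mem_convexHull_range_perm (hv n)
  rw [← convexHull_pi, mem_convexHull_iff_exists_fintype] at hmem
  obtain ⟨κ, hκ, t, z, ht, ht1, hz, hsum⟩ := hmem
  choose σ hσ using fun k n => hz k n (Set.mem_univ n)
  refine ⟨κ, hκ, t, σ, ht, ht1, fun n b => ?_⟩
  simp only [← hsum, ← hσ, Finset.sum_apply, Pi.smul_apply, smul_eq_mul, Function.comp_apply]

end Majorization

section Norms

variable {α β : Type*} [Fintype α] [Fintype β]

lemma ofReal_normSq (x : Matrix α β ℂ) : (normSq x : ℂ) = (x * xᴴ).trace := by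
  simp [normSq, Matrix.trace, Matrix.mul_apply, Complex.mul_conj']

lemma normSq_nonneg (x : Matrix α β ℂ) : 0 ≤ normSq x := by
  unfold normSq
  positivity

open scoped ComplexOrder in
lemma normSq_eq_zero {x : Matrix α β ℂ} : normSq x = 0 ↔ x = 0 := by
  rw [← Complex.ofReal_inj, ofReal_normSq, Complex.ofReal_zero,
    Matrix.trace_mul_conjTranspose_self_eq_zero_iff]

lemma normSq_pos {x : Matrix α β ℂ} : 0 < normSq x ↔ x ≠ 0 :=
  (normSq_nonneg x).lt_iff_ne'.trans normSq_eq_zero.not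

lemma normSq_smul (c : ℂ) (x : Matrix α β ℂ) : normSq (c • x) = ‖c‖ ^ 2 * normSq x := by
  simp [normSq, Finset.mul_sum, mul_pow]

lemma norm_ofReal_sqrt_sq {a : ℝ} (ha : 0 ≤ a) : ‖(Real.sqrt a : ℂ)‖ ^ 2 = a := by
  rw [Complex.norm_real, Real.norm_eq_abs, sq_abs, Real.sq_sqrt ha]

lemma normSq_normalize {x : Matrix α β ℂ} (hx : x ≠ 0) : normSq (normalize x) = 1 := by
  rw [normalize, normSq_smul, Complex.ofReal_inv, norm_inv, inv_pow,
    norm_ofReal_sqrt_sq (normSq_nonneg x), inv_mul_cancel₀ (normSq_pos.mpr hx).ne']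

lemma normalize_normalize (x : Matrix α β ℂ) : normalize (normalize x) = normalize x := by
  obtain rfl | hx := eq_or_ne x 0
  · simp [normalize]
  · rw [normalize, normSq_normalize hx, Real.sqrt_one, inv_one, Complex.ofReal_one, one_smul]

lemma sqrt_normSq_smul_normalize (x : Matrix α β ℂ) :
    (Real.sqrt (normSq x) : ℂ) • normalize x = x := by
  obtain rfl | hx := eq_or_ne x 0
  · simp [normalize]
  · rw [normalize, smul_smul, ← Complex.ofReal_mul,
      mul_inv_cancel₀ (Real.sqrt_pos.mpr (normSq_pos.mpr hx)).ne', Complex.ofReal_one, one_smul]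

lemma normSq_mul_normSq_normalize (x : Matrix α β ℂ) :
    normSq x * normSq (normalize x) = normSq x := by
  conv_rhs => rw [← sqrt_normSq_smul_normalize x, normSq_smul,
    norm_ofReal_sqrt_sq (normSq_nonneg x)]

lemma sum_normSq_actA [DecidableEq α] {J : Type*} [Fintype J] {M : J → Matrix α α ℂ}
    (hM : ∑ j, star (M j) * M j = 1) (x : Matrix α β ℂ) :
    ∑ j, normSq (actA (M j) x) = normSq x := by
  have hterm (j : J) : (M j * x * (M j * x)ᴴ).trace = (star (M j) * M j * (x * xᴴ)).trace := by
    rw [Matrix.star_eq_conjTranspose, Matrix.conjTranspose_mul, ← Matrix.mul_assoc,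
      Matrix.trace_mul_comm]
    simp only [Matrix.mul_assoc]
  rw [← Complex.ofReal_inj, Complex.ofReal_sum]
  simp only [ofReal_normSq, actA, hterm]
  rw [← Matrix.trace_sum, ← Finset.sum_mul, hM, Matrix.one_mul]

lemma sum_normSq_actB [DecidableEq β] {J : Type*} [Fintype J] {M : J → Matrix β β ℂ}
    (hM : ∑ j, star (M j) * M j = 1) (x : Matrix α β ℂ) :
    ∑ j, normSq (actB (M j) x) = normSq x := by
  have hterm (j : J) : x * (M j)ᵀ * (x * (M j)ᵀ)ᴴ = x * (star (M j) * M j)ᵀ * xᴴ := by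
    rw [Matrix.conjTranspose_mul, Matrix.star_eq_conjTranspose, Matrix.transpose_mul]
    simp only [Matrix.mul_assoc]
    rfl
  rw [← Complex.ofReal_inj, Complex.ofReal_sum]
  simp only [ofReal_normSq, actB, hterm]
  rw [← Matrix.trace_sum, ← Matrix.sum_mul, ← Matrix.mul_sum, ← Matrix.transpose_sum, hM,
    Matrix.transpose_one, Matrix.mul_one]

lemma normSq_mul_add_normSq_one_sub_mul [DecidableEq α] {Q : Matrix α α ℂ}
    (hQ : IsStarProjection Q) (x : Matrix α β ℂ) :
    normSq (Q * x) + normSq ((1 - Q) * x) = normSq x := by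
  have hcomplete : ∑ j : Bool, star (cond j Q (1 - Q)) * cond j Q (1 - Q) = 1 := by
    simp [hQ.isSelfAdjoint.star_eq, hQ.one_sub.isSelfAdjoint.star_eq, hQ.isIdempotentElem.eq,
      hQ.one_sub.isIdempotentElem.eq, -star_sub]
  simpa [actA] using sum_normSq_actA hcomplete x

end Norms

section SchmidtBasis

open scoped ComplexOrder

variable {α β : Type*} [Fintype α] [DecidableEq α] [Fintype β]

lemma schmidtVector_antitone (x : Matrix α β ℂ) : Antitone (schmidtVector x) :=
  Matrix.IsHermitian.eigenvalues₀_antitone _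

lemma schmidtVector_nonneg (x : Matrix α β ℂ) (l) : 0 ≤ schmidtVector x l := by
  simpa [Matrix.IsHermitian.eigenvalues, schmidtVector] using
    (Matrix.posSemidef_self_mul_conjTranspose x).eigenvalues_nonneg
      ((Fintype.equivOfCardEq (Fintype.card_fin _)) l)

/-- Alice's Schmidt basis of `x`: the columns form an orthonormal eigenbasis of the reduced operator
`x * xᴴ`, indexed like the eigenvalues in `schmidtVector x`. -/
noncomputable def schmidtBasis (x : Matrix α β ℂ) : Matrix α (Fin (Fintype.card α)) ℂ :=
  Matrix.submatrix (Matrix.isHermitian_mul_conjTranspose_self x).eigenvectorUnitary.val id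
    (Fintype.equivOfCardEq (Fintype.card_fin _))

lemma conjTranspose_schmidtBasis_mul_self (x : Matrix α β ℂ) :
    (schmidtBasis x)ᴴ * schmidtBasis x = 1 := by
  rw [schmidtBasis, Matrix.conjTranspose_submatrix,
    ← Matrix.submatrix_mul _ _ _ _ _ Function.bijective_id, ← Matrix.star_eq_conjTranspose,
    Unitary.coe_star_mul_self, Matrix.submatrix_one_equiv]

lemma schmidtBasis_mul_conjTranspose_self (x : Matrix α β ℂ) :
    schmidtBasis x * (schmidtBasis x)ᴴ = 1 := by
  rw [schmidtBasis, Matrix.conjTranspose_submatrix, Matrix.submatrix_mul_equiv,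
    Matrix.submatrix_id_id, ← Matrix.star_eq_conjTranspose]
  exact Unitary.coe_mul_star_self _

lemma mul_conjTranspose_self_eq_schmidt (x : Matrix α β ℂ) :
    x * xᴴ = schmidtBasis x * Matrix.diagonal (fun l => (schmidtVector x l : ℂ)) *
      (schmidtBasis x)ᴴ := by
  let hx := Matrix.isHermitian_mul_conjTranspose_self x
  have hdiag : Matrix.diagonal (fun l => (schmidtVector x l : ℂ)) =
      (Matrix.diagonal (RCLike.ofReal ∘ hx.eigenvalues : α → ℂ)).submatrix
        (Fintype.equivOfCardEq (Fintype.card_fin _))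
        (Fintype.equivOfCardEq (Fintype.card_fin _)) := by
    rw [Matrix.submatrix_diagonal_equiv]
    congr 1
    ext l
    simp [Matrix.IsHermitian.eigenvalues, schmidtVector]
  conv_lhs => rw [hx.spectral_theorem, Unitary.conjStarAlgAut_apply]
  rw [hdiag, schmidtBasis, Matrix.conjTranspose_submatrix, Matrix.submatrix_mul_equiv,
    Matrix.submatrix_mul_equiv, Matrix.submatrix_id_id, Matrix.star_eq_conjTranspose]

lemma sum_schmidtVector (x : Matrix α β ℂ) : ∑ l, schmidtVector x l = normSq x := by
  rw [← Complex.ofReal_inj, ofReal_normSq, mul_conjTranspose_self_eq_schmidt,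
    Matrix.trace_mul_comm, ← Matrix.mul_assoc, conjTranspose_schmidtBasis_mul_self,
    Matrix.one_mul, Matrix.trace_diagonal, Complex.ofReal_sum]

end SchmidtBasis

section EckartYoung

lemma isStarProjection_conj {m n : Type*} [Fintype m] [Fintype n] [DecidableEq n]
    {V : Matrix m n ℂ} {D : Matrix n n ℂ} (hV : Vᴴ * V = 1) (hD : IsStarProjection D) :
    IsStarProjection (V * D * Vᴴ) where
  isSelfAdjoint := Matrix.isHermitian_mul_mul_conjTranspose V hD.isSelfAdjoint
  isIdempotentElem := by
    calc V * D * Vᴴ * (V * D * Vᴴ) = V * (D * (Vᴴ * V) * D) * Vᴴ := by simp only [Matrix.mul_assoc]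
      _ = V * D * Vᴴ := by rw [hV, Matrix.mul_one, hD.isIdempotentElem.eq]

lemma isStarProjection_diagonal_ite {n : Type*} [Fintype n] [DecidableEq n] (P : n → Prop)
    [DecidablePred P] :
    IsStarProjection (Matrix.diagonal fun l => if P l then (1 : ℂ) else 0) where
  isIdempotentElem := by simp [IsIdempotentElem]
  isSelfAdjoint := Matrix.isHermitian_diagonal_of_self_adjoint _ <| funext fun l => by
    simp [apply_ite star]

open scoped ComplexOrder in
lemma re_apply_self_mem_Icc_of_isStarProjection {m : Type*} [Fintype m]
    {E : Matrix m m ℂ} (hE : IsStarProjection E) (l : m) : (E l l).re ∈ Set.Icc (0 : ℝ) 1 := by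
  classical
  have re_nonneg {F : Matrix m m ℂ} (hF : IsStarProjection F) : 0 ≤ (F l l).re := by
    have hpos : F.PosSemidef := by
      rw [← hF.isIdempotentElem.eq]
      nth_rw 1 [← hF.isSelfAdjoint.star_eq]
      exact Matrix.posSemidef_conjTranspose_mul_self F
    exact (Complex.nonneg_iff.mp hpos.diag_nonneg).1
  refine ⟨re_nonneg hE, ?_⟩
  simpa using re_nonneg hE.one_sub

lemma sum_mul_le_sum_of_antitone {d : ℕ} {v q : Fin d → ℝ} (hv : Antitone v) (hv0 : ∀ l, 0 ≤ v l)
    (hq : ∀ l, q l ∈ Set.Icc (0 : ℝ) 1) {k : ℕ} (hk : ∑ l, q l ≤ k) :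
    ∑ l, v l * q l ≤ ∑ l with l.val < k, v l := by
  by_cases hkd : k < d
  · let c := v ⟨k, hkd⟩
    have hshifted : ∑ l, (v l - c) * q l ≤ ∑ l with l.val < k, (v l - c) := by
      rw [Finset.sum_filter]
      refine Finset.sum_le_sum fun l _ => ?_
      split_ifs with hl
      · exact mul_le_of_le_one_right (sub_nonneg.mpr (hv (Fin.le_def.mpr hl.le))) (hq l).2
      · exact mul_nonpos_of_nonpos_of_nonneg
          (sub_nonpos.mpr (hv (Fin.le_def.mpr (not_lt.mp hl)))) (hq l).1
    have hconst : ∑ l : Fin d with l.val < k, c = k * c := by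
      rw [sum_filter_val_lt hkd.le fun _ => c, Finset.sum_const, Finset.card_range, nsmul_eq_mul]
    have hmass : (∑ l, q l) * c ≤ k * c := mul_le_mul_of_nonneg_right hk (hv0 ⟨k, hkd⟩)
    rw [Finset.sum_sub_distrib, hconst] at hshifted
    simp only [sub_mul, Finset.sum_sub_distrib, ← Finset.mul_sum] at hshifted
    linarith [mul_comm c (∑ l, q l)]
  · rw [Finset.filter_true_of_mem fun l _ => by omega]
    exact Finset.sum_le_sum fun l _ => mul_le_of_le_one_right (hv0 l) (hq l).2

lemma exists_isStarProjection_mul_eq_self {α β : Type*} [Fintype α] [Fintype β]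
    (z : Matrix α β ℂ) :
    ∃ Q : Matrix α α ℂ, IsStarProjection Q ∧ Q * z = z ∧ Q.trace = z.rank := by
  classical
  let K : Submodule ℂ (EuclideanSpace ℂ α) := LinearMap.range (z.toLpLin 2 2)
  have hK : IsStarProjection K.starProjection := isStarProjection_starProjection
  let e := Matrix.toEuclideanCLM (n := α) (𝕜 := ℂ)
  obtain ⟨Q, hQ⟩ := e.surjective K.starProjection
  have hQv (v : EuclideanSpace ℂ α) : Q.toLpLin 2 2 v = K.starProjection v :=
    DFunLike.congr_fun hQ v
  refine ⟨Q, ⟨e.injective ?_, e.injective ?_⟩, ?_, ?_⟩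
  · rw [map_mul, hQ, hK.isIdempotentElem.eq]
  · exact (map_star e Q).trans ((congrArg star hQ).trans (hK.isSelfAdjoint.star_eq.trans hQ.symm))
  · refine (Matrix.toLpLin 2 2).injective (LinearMap.ext fun v => ?_)
    calc (Q * z).toLpLin 2 2 v = Q.toLpLin 2 2 (z.toLpLin 2 2 v) := by
          simp [Matrix.toLpLin_apply, Matrix.mulVec_mulVec]
      _ = z.toLpLin 2 2 v := by
          rw [hQv]
          exact Submodule.starProjection_eq_self_iff.mpr (LinearMap.mem_range_self _ v)
  · have hproj : LinearMap.IsProj K (Q.toLpLin 2 2) :=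
      ⟨fun v => hQv v ▸ K.starProjection_apply_mem v,
        fun v hv => (hQv v).trans (Submodule.starProjection_eq_self_iff.mpr hv)⟩
    calc Q.trace = LinearMap.trace ℂ _ (Q.toLpLin 2 2) := by
          rw [Matrix.toLpLin_eq_toLin, Matrix.trace_toLin_eq]
      _ = Module.finrank ℂ K := hproj.trace
      _ = z.rank := by
          rw [Matrix.rank_eq_finrank_range_toLin z (PiLp.basisFun 2 ℂ α) (PiLp.basisFun 2 ℂ β),
            ← Matrix.toLpLin_eq_toLin]

variable {α β : Type*} [Fintype α] [DecidableEq α] [Fintype β]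

lemma normSq_mul_eq_sum {Q : Matrix α α ℂ} (hQ : IsStarProjection Q) (x : Matrix α β ℂ) :
    normSq (Q * x) =
      ∑ l, schmidtVector x l * (((schmidtBasis x)ᴴ * Q * schmidtBasis x) l l).re := by
  have htrace : (normSq (Q * x) : ℂ) = (Matrix.diagonal (fun l => (schmidtVector x l : ℂ)) *
      ((schmidtBasis x)ᴴ * Q * schmidtBasis x)).trace := by
    calc (normSq (Q * x) : ℂ) = (Q * (x * xᴴ) * Q).trace := by
          rw [ofReal_normSq, Matrix.conjTranspose_mul, ← Matrix.star_eq_conjTranspose Q,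
            hQ.isSelfAdjoint.star_eq]
          simp only [Matrix.mul_assoc]
      _ = (x * xᴴ * Q).trace := by
          rw [Matrix.trace_mul_cycle, hQ.isIdempotentElem.eq, Matrix.trace_mul_comm]
      _ = _ := by
          rw [mul_conjTranspose_self_eq_schmidt, Matrix.mul_assoc, Matrix.mul_assoc,
            Matrix.trace_mul_comm]
          simp only [Matrix.mul_assoc]
  simpa [Matrix.trace, Matrix.diagonal_mul] using congrArg Complex.re htrace

/-- Ky Fan's maximum principle. -/
lemma normSq_mul_le {Q : Matrix α α ℂ} (hQ : IsStarProjection Q) {k : ℕ} (hk : Q.trace.re ≤ k)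
    (x : Matrix α β ℂ) : normSq (Q * x) ≤ ∑ l with l.val < k, schmidtVector x l := by
  have hproj : IsStarProjection ((schmidtBasis x)ᴴ * Q * schmidtBasis x) := by
    simpa using isStarProjection_conj (V := (schmidtBasis x)ᴴ)
      (by rw [Matrix.conjTranspose_conjTranspose, schmidtBasis_mul_conjTranspose_self]) hQ
  rw [normSq_mul_eq_sum hQ]
  refine sum_mul_le_sum_of_antitone (schmidtVector_antitone x) (schmidtVector_nonneg x)
    (re_apply_self_mem_Icc_of_isStarProjection hproj) (hk.trans' (le_of_eq ?_))
  calc ∑ l, (((schmidtBasis x)ᴴ * Q * schmidtBasis x) l l).re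
      = ((schmidtBasis x)ᴴ * Q * schmidtBasis x).trace.re := by
        rw [Matrix.trace, Complex.re_sum]
        rfl
    _ = Q.trace.re := by
        rw [Matrix.trace_mul_cycle, schmidtBasis_mul_conjTranspose_self, Matrix.one_mul]

/-- The part of `⟨x|x⟩` that is not carried by the `k` largest Schmidt coefficients: Vidal's
entanglement monotones. -/
noncomputable def schmidtTail (k : ℕ) (x : Matrix α β ℂ) : ℝ :=
  ∑ l with k ≤ l.val, schmidtVector x l

lemma sum_schmidtVector_lt_add_schmidtTail (k : ℕ) (x : Matrix α β ℂ) :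
    ∑ l with l.val < k, schmidtVector x l + schmidtTail k x = normSq x := by
  simpa only [schmidtTail, not_lt, sum_schmidtVector] using
    Finset.sum_filter_add_sum_filter_not Finset.univ (·.val < k) (schmidtVector x)

lemma schmidtTail_nonneg (k : ℕ) (x : Matrix α β ℂ) : 0 ≤ schmidtTail k x :=
  Finset.sum_nonneg fun l _ => schmidtVector_nonneg x l

/-- The lower bound of the Eckart–Young theorem. -/
lemma schmidtTail_le_normSq_sub {k : ℕ} (x : Matrix α β ℂ) {z : Matrix α β ℂ} (hz : z.rank ≤ k) :
    schmidtTail k x ≤ normSq (x - z) := by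
  obtain ⟨Q, hQ, hQz, htrace⟩ := exists_isStarProjection_mul_eq_self z
  have hkyFan : normSq (Q * x) ≤ ∑ l with l.val < k, schmidtVector x l :=
    normSq_mul_le hQ (by rw [htrace]; exact_mod_cast hz) x
  calc schmidtTail k x ≤ normSq ((1 - Q) * x) := by
        linarith [normSq_mul_add_normSq_one_sub_mul hQ x, sum_schmidtVector_lt_add_schmidtTail k x]
    _ = normSq ((1 - Q) * (x - z)) := by
        rw [Matrix.mul_sub, Matrix.sub_mul _ _ z, hQz, Matrix.one_mul, sub_self, sub_zero]
    _ ≤ normSq (x - z) := by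
        linarith [normSq_mul_add_normSq_one_sub_mul hQ (x - z), normSq_nonneg (Q * (x - z))]

lemma exists_rank_le_normSq_sub_eq_schmidtTail (k : ℕ) (x : Matrix α β ℂ) :
    ∃ z : Matrix α β ℂ, z.rank ≤ k ∧ normSq (x - z) = schmidtTail k x := by
  let V := schmidtBasis x
  let D : Matrix (Fin (Fintype.card α)) (Fin (Fintype.card α)) ℂ :=
    Matrix.diagonal fun l => if l.val < k then 1 else 0
  have hV : Vᴴ * V = 1 := conjTranspose_schmidtBasis_mul_self x
  have hD : IsStarProjection D := isStarProjection_diagonal_ite _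
  have hrank : D.rank ≤ k := by
    simp [D, Matrix.rank_diagonal, Fintype.card_subtype, Fin.card_filter_val_lt]
  have hVDV : Vᴴ * (1 - V * D * Vᴴ) * V = 1 - D := by
    calc Vᴴ * (1 - V * D * Vᴴ) * V = Vᴴ * V - Vᴴ * V * D * (Vᴴ * V) := by
          simp only [Matrix.mul_sub, Matrix.sub_mul, Matrix.mul_one, Matrix.mul_assoc]
      _ = 1 - D := by rw [hV, Matrix.one_mul, Matrix.mul_one]
  refine ⟨V * D * Vᴴ * x, ?_, ?_⟩
  · exact ((Matrix.rank_mul_le_left _ x).trans (Matrix.rank_mul_le_left _ Vᴴ)).trans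
      ((Matrix.rank_mul_le_right V D).trans hrank)
  · calc normSq (x - V * D * Vᴴ * x) = normSq ((1 - V * D * Vᴴ) * x) := by
          rw [Matrix.sub_mul, Matrix.one_mul]
      _ = ∑ l, schmidtVector x l * ((1 - D) l l).re := by
          rw [normSq_mul_eq_sum (isStarProjection_conj hV hD).one_sub, hVDV]
      _ = schmidtTail k x := by
          rw [schmidtTail, Finset.sum_filter]
          refine Finset.sum_congr rfl fun l _ => ?_
          obtain hl | hl := lt_or_ge l.val k
          · simp [D, hl]
          · simp [D, hl, hl.not_gt]

lemma schmidtTail_smul (k : ℕ) (c : ℂ) (x : Matrix α β ℂ) :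
    schmidtTail k (c • x) = ‖c‖ ^ 2 * schmidtTail k x := by
  have tail_smul_le (c : ℂ) (x : Matrix α β ℂ) :
      schmidtTail k (c • x) ≤ ‖c‖ ^ 2 * schmidtTail k x := by
    obtain ⟨z, hz, hxz⟩ := exists_rank_le_normSq_sub_eq_schmidtTail k x
    have hcz : (c • z).rank ≤ z.rank := by
      simpa using Matrix.rank_mul_le_right (c • (1 : Matrix α α ℂ)) z
    rw [← hxz, ← normSq_smul, smul_sub]
    exact schmidtTail_le_normSq_sub _ (hcz.trans hz)
  refine (tail_smul_le c x).antisymm ?_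
  obtain rfl | hc := eq_or_ne c 0
  · simpa using schmidtTail_nonneg k (0 : Matrix α β ℂ)
  · calc ‖c‖ ^ 2 * schmidtTail k x = ‖c‖ ^ 2 * schmidtTail k (c⁻¹ • c • x) := by
          rw [inv_smul_smul₀ hc]
      _ ≤ ‖c‖ ^ 2 * (‖c⁻¹‖ ^ 2 * schmidtTail k (c • x)) := by
          gcongr
          exact tail_smul_le c⁻¹ (c • x)
      _ = schmidtTail k (c • x) := by
          rw [norm_inv, ← mul_assoc, ← mul_pow, mul_inv_cancel₀ (norm_ne_zero_iff.mpr hc),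
            one_pow, one_mul]

lemma schmidtVector_eq_schmidtTail_sub (x : Matrix α β ℂ) (l : Fin (Fintype.card α)) :
    schmidtVector x l = schmidtTail l x - schmidtTail (l + 1) x := by
  have hinsert : Finset.univ.filter (fun j : Fin (Fintype.card α) => l.val ≤ j.val) =
      insert l (Finset.univ.filter fun j => l.val + 1 ≤ j.val) := by
    ext j
    simp [Fin.ext_iff]
    omega
  rw [schmidtTail, schmidtTail, hinsert, Finset.sum_insert (by simp), add_sub_cancel_right]

lemma schmidtVector_smul (c : ℂ) (x : Matrix α β ℂ) :
    schmidtVector (c • x) = ‖c‖ ^ 2 • schmidtVector x := by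
  ext l
  simp only [Pi.smul_apply, smul_eq_mul, schmidtVector_eq_schmidtTail_sub, schmidtTail_smul,
    mul_sub]

lemma sum_schmidtTail_actA_le {J : Type*} [Fintype J] {M : J → Matrix α α ℂ}
    (hM : ∑ j, star (M j) * M j = 1) (k : ℕ) (x : Matrix α β ℂ) :
    ∑ j, schmidtTail k (actA (M j) x) ≤ schmidtTail k x := by
  obtain ⟨z, hz, hxz⟩ := exists_rank_le_normSq_sub_eq_schmidtTail k x
  rw [← hxz, ← sum_normSq_actA hM]
  refine Finset.sum_le_sum fun j _ => ?_
  rw [actA, actA, Matrix.mul_sub]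
  exact schmidtTail_le_normSq_sub _ ((Matrix.rank_mul_le_right _ _).trans hz)

lemma sum_schmidtTail_actB_le [DecidableEq β] {J : Type*} [Fintype J] {M : J → Matrix β β ℂ}
    (hM : ∑ j, star (M j) * M j = 1) (k : ℕ) (x : Matrix α β ℂ) :
    ∑ j, schmidtTail k (actB (M j) x) ≤ schmidtTail k x := by
  obtain ⟨z, hz, hxz⟩ := exists_rank_le_normSq_sub_eq_schmidtTail k x
  rw [← hxz, ← sum_normSq_actB hM]
  refine Finset.sum_le_sum fun j _ => ?_
  rw [actB, actB, Matrix.sub_mul]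
  exact schmidtTail_le_normSq_sub _ ((Matrix.rank_mul_le_left _ _).trans hz)

end EckartYoung

section Monotonicity

variable {α β ι : Type*} [Fintype α] [DecidableEq α] [Fintype β]

lemma normSq_mul_schmidtTail_normalize (k : ℕ) (x : Matrix α β ℂ) :
    normSq x * schmidtTail k (normalize x) = schmidtTail k x := by
  conv_rhs => rw [← sqrt_normSq_smul_normalize x, schmidtTail_smul,
    norm_ofReal_sqrt_sq (normSq_nonneg x)]

lemma normSq_smul_schmidtVector_normalize (x : Matrix α β ℂ) :
    normSq x • schmidtVector (normalize x) = schmidtVector x := by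
  conv_rhs => rw [← sqrt_normSq_smul_normalize x, schmidtVector_smul,
    norm_ofReal_sqrt_sq (normSq_nonneg x)]

variable [Fintype ι]

lemma sum_sum_smul_schmidtVector (p : ι → ℝ) (y : ι → Matrix α β ℂ) :
    ∑ l, (∑ i, p i • schmidtVector (y i)) l = ∑ i, p i * normSq (y i) := by
  simp only [Finset.sum_apply, Pi.smul_apply, smul_eq_mul]
  rw [Finset.sum_comm]
  simp only [← Finset.mul_sum, sum_schmidtVector]

variable [DecidableEq β]

lemma Protocol.sum_prob_mul_normSq_normalize {ψ : ι → Matrix α β ℂ} {χ : Matrix α β ℂ}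
    {P : Protocol (Matrix α α ℂ) (Matrix β β ℂ) ι} (h : P.Yields actA actB ψ χ) :
    ∑ i, P.prob actA actB normSq i χ * normSq (normalize (ψ i)) = normSq χ := by
  classical
  induction P generalizing χ with
  | done i =>
    obtain ⟨c, rfl⟩ := h
    simp only [Protocol.prob, ite_mul, zero_mul, Finset.sum_ite_eq, Finset.mem_univ, if_true,
      normSq_smul, mul_assoc, normSq_mul_normSq_normalize]
  | alice k M hM next ih =>
    simp only [Protocol.prob, Finset.sum_mul]
    rw [Finset.sum_comm, ← sum_normSq_actA hM]
    exact Finset.sum_congr rfl fun j _ => ih j (h j)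
  | bob k M hM next ih =>
    simp only [Protocol.prob, Finset.sum_mul]
    rw [Finset.sum_comm, ← sum_normSq_actB hM]
    exact Finset.sum_congr rfl fun j _ => ih j (h j)

lemma Protocol.sum_prob_mul_schmidtTail_normalize_le {ψ : ι → Matrix α β ℂ} {χ : Matrix α β ℂ}
    {P : Protocol (Matrix α α ℂ) (Matrix β β ℂ) ι} (h : P.Yields actA actB ψ χ) (k : ℕ) :
    ∑ i, P.prob actA actB normSq i χ * schmidtTail k (normalize (ψ i)) ≤ schmidtTail k χ := by
  classical
  induction P generalizing χ with
  | done i =>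
    obtain ⟨c, rfl⟩ := h
    simp only [Protocol.prob, ite_mul, zero_mul, Finset.sum_ite_eq, Finset.mem_univ, if_true,
      normSq_smul, schmidtTail_smul, mul_assoc, normSq_mul_schmidtTail_normalize, le_refl]
  | alice n M hM next ih =>
    simp only [Protocol.prob, Finset.sum_mul]
    rw [Finset.sum_comm]
    exact (Finset.sum_le_sum fun j _ => ih j (h j)).trans (sum_schmidtTail_actA_le hM k χ)
  | bob n M hM next ih =>
    simp only [Protocol.prob, Finset.sum_mul]
    rw [Finset.sum_comm]
    exact (Finset.sum_le_sum fun j _ => ih j (h j)).trans (sum_schmidtTail_actB_le hM k χ)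

namespace LOCCConverts

variable {x : Matrix α β ℂ} {p : ι → ℝ} {y : ι → Matrix α β ℂ}

theorem majorizedBy (h : LOCCConverts x p y) :
    MajorizedBy (schmidtVector x) (∑ i, p i • schmidtVector (normalize (y i))) := by
  obtain ⟨P, hP, hprob⟩ := h
  have htotal := P.sum_prob_mul_normSq_normalize hP
  have htail := P.sum_prob_mul_schmidtTail_normalize_le hP
  simp only [hprob] at htotal htail
  refine MajorizedBy.of_sum_tail_le ?_ fun k => ?_
  · rw [sum_schmidtVector, sum_sum_smul_schmidtVector, htotal]
  · simp only [Finset.sum_apply, Pi.smul_apply, smul_eq_mul]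
    rw [Finset.sum_comm]
    simpa only [← Finset.mul_sum, schmidtTail] using htail k

theorem majorizedBy_of_normalize (hx : x ≠ 0)
    (h : LOCCConverts (normalize x) (fun i => p i * normSq (y i) / normSq x)
      (fun i => normalize (y i))) :
    MajorizedBy (schmidtVector x) (∑ i, p i • schmidtVector (y i)) := by
  convert h.majorizedBy.smul (normSq_nonneg x) using 1
  · rw [normSq_smul_schmidtVector_normalize]
  · rw [Finset.smul_sum]
    refine Finset.sum_congr rfl fun i _ => ?_
    rw [normalize_normalize, smul_smul, mul_div_cancel₀ _ (normSq_pos.mpr hx).ne', mul_smul,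
      normSq_smul_schmidtVector_normalize]

end LOCCConverts

end Monotonicity

section Sectors

namespace Protocol

section Map

variable {R S R' S' ι V W : Type*} [Ring R] [StarRing R] [Algebra ℂ R] [Ring S] [StarRing S]
  [Algebra ℂ S] [Ring R'] [StarRing R'] [Algebra ℂ R'] [Ring S'] [StarRing S'] [Algebra ℂ S']

/-- The protocol with all measurement operators transported along star homomorphisms. -/
def map (f : R →⋆ₐ[ℂ] R') (g : S →⋆ₐ[ℂ] S') : Protocol R S ι → Protocol R' S' ι
  | .done i => .done i
  | .alice k M hM next =>
    .alice k (fun j => f (M j)) (by simp only [← map_star, ← map_mul, ← map_sum, hM, map_one])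
      fun j => (next j).map f g
  | .bob k M hM next =>
    .bob k (fun j => g (M j)) (by simp only [← map_star, ← map_mul, ← map_sum, hM, map_one])
      fun j => (next j).map f g

variable [SMul ℂ V] {f : R →⋆ₐ[ℂ] R'} {g : S →⋆ₐ[ℂ] S'}
  {actR : R → V → V} {actS : S → V → V} {actR' : R' → W → W} {actS' : S' → W → W} {T : V → W}
  {ψ : ι → V} {P : Protocol R S ι} {χ : V}

lemma Yields.map [SMul ℂ W] {ψ' : ι → W} (h : P.Yields actR actS ψ χ)
    (hR : ∀ M x, T (actR M x) = actR' (f M) (T x))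
    (hS : ∀ M x, T (actS M x) = actS' (g M) (T x))
    (hψ : ∀ i (c : ℂ), ∃ c' : ℂ, T (c • ψ i) = c' • ψ' i) :
    (P.map f g).Yields actR' actS' ψ' (T χ) := by
  induction P generalizing χ with
  | done i =>
    obtain ⟨c, rfl⟩ := h
    exact hψ i c
  | alice k M hM next ih => exact fun j => hR (M j) χ ▸ ih j (h j)
  | bob k M hM next ih => exact fun j => hS (M j) χ ▸ ih j (h j)

lemma Yields.prob_map {normSqV : V → ℝ} {normSqW : W → ℝ} {r : ι → ℝ}
    (h : P.Yields actR actS ψ χ) (hR : ∀ M x, T (actR M x) = actR' (f M) (T x))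
    (hS : ∀ M x, T (actS M x) = actS' (g M) (T x))
    (hr : ∀ i (c : ℂ), normSqW (T (c • ψ i)) = r i * normSqV (c • ψ i)) (i : ι) :
    (P.map f g).prob actR' actS' normSqW i (T χ) = r i * P.prob actR actS normSqV i χ := by
  induction P generalizing χ with
  | done i' =>
    obtain ⟨c, rfl⟩ := h
    simp only [Protocol.map, Protocol.prob, mul_ite, mul_zero]
    split_ifs with hi
    · exact hi ▸ hr i' c
    · rfl
  | alice k M hM next ih =>
    simp only [Protocol.map, Protocol.prob, Finset.mul_sum, ← hR]
    exact Finset.sum_congr rfl fun j _ => ih j (h j)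
  | bob k M hM next ih =>
    simp only [Protocol.map, Protocol.prob, Finset.mul_sum, ← hS]
    exact Finset.sum_congr rfl fun j _ => ih j (h j)

end Map

end Protocol

variable {A B : ℕ → Type*} [∀ n, Fintype (A n)] [∀ n, Fintype (B n)] {N : ℕ}

lemma State.normSq_smul (c : ℂ) (φ : State A B N) : (c • φ).normSq = ‖c‖ ^ 2 * φ.normSq := by
  simp only [State.normSq, Pi.smul_apply, SSR.normSq_smul, Finset.mul_sum]

variable [∀ n, DecidableEq (A n)] [∀ n, DecidableEq (B n)] {ι : Type*} {φ : State A B N}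
  {p : ι → ℝ} {ψ : ι → State A B N}

lemma SSRConverts.loccConverts (h : SSRConverts φ p ψ) (hψ : ∀ i, (ψ i).normSq = 1)
    (n : Fin (N + 1)) :
    LOCCConverts (normalize (φ n)) (fun i => p i * normSq (ψ i n) / normSq (φ n))
      (fun i => normalize (ψ i n)) := by
  obtain ⟨P, hP, hprob⟩ := h
  let a : ℂ := ((Real.sqrt (normSq (φ n)))⁻¹ : ℝ)
  have ha : ‖a‖ ^ 2 = (normSq (φ n))⁻¹ := by
    rw [show a = _ from Complex.ofReal_inv _, norm_inv, inv_pow,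
      norm_ofReal_sqrt_sq (normSq_nonneg _)]
  let f := Pi.evalStarAlgHom ℂ (fun m => Matrix (A m) (A m) ℂ) n
  let g := Pi.evalStarAlgHom ℂ (fun m => Matrix (B m) (B m) ℂ) (N - n)
  let T (χ : State A B N) : Matrix (A n) (B (N - n)) ℂ := a • χ n
  have hf (M : LocalOp A) (χ) : T (State.actA M χ) = actA (f M) (T χ) :=
    (Matrix.mul_smul (M n) a (χ n)).symm
  have hg (M : LocalOp B) (χ) : T (State.actB M χ) = actB (g M) (T χ) :=
    (Matrix.smul_mul a (χ n) (M (N - n))ᵀ).symm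
  refine ⟨P.map f g, hP.map (T := T) hf hg fun i c => ⟨a * c * Real.sqrt (normSq (ψ i n)), ?_⟩,
    fun i => ?_⟩
  · rw [mul_smul, sqrt_normSq_smul_normalize, mul_smul]
    rfl
  · have hr (i : ι) (c : ℂ) :
        normSq (T (c • ψ i)) = normSq (ψ i n) / normSq (φ n) * (c • ψ i).normSq := by
      simp only [T, Pi.smul_apply, normSq_smul, State.normSq_smul, hψ, ha]
      ring
    exact (hP.prob_map (T := T) hf hg hr i).trans (by rw [hprob]; ring)

theorem majorizedBy_of_loccConverts [Fintype ι] (hφ : φ.normSq = 1) (hp : ∀ i, 0 ≤ p i)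
    (hp1 : ∑ i, p i = 1) (hψ : ∀ i, (ψ i).normSq = 1)
    (h : ∀ n, φ n ≠ 0 → LOCCConverts (normalize (φ n))
      (fun i => p i * normSq (ψ i n) / normSq (φ n)) (fun i => normalize (ψ i n)))
    (n : Fin (N + 1)) :
    MajorizedBy (ssrSchmidtVector φ n) (∑ i, p i • ssrSchmidtVector (ψ i) n) := by
  have hmaj (m : Fin (N + 1)) (hm : φ m ≠ 0) := (h m hm).majorizedBy_of_normalize hm
  have hle (m : Fin (N + 1)) : normSq (φ m) ≤ ∑ i, p i * normSq (ψ i m) := by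
    by_cases hm : φ m = 0
    · rw [normSq_eq_zero.mpr hm]
      exact Finset.sum_nonneg fun i _ => mul_nonneg (hp i) (normSq_nonneg _)
    · rw [← sum_schmidtVector, ← sum_sum_smul_schmidtVector]
      exact (hmaj m hm).2.le
  have htotal : ∑ m, normSq (φ m) = ∑ m, ∑ i, p i * normSq (ψ i m) := by
    have hψ1 (i : ι) : ∑ m, normSq (ψ i m) = 1 := hψ i
    rw [Finset.sum_comm]
    simp only [← Finset.mul_sum, hψ1, mul_one, hp1]
    exact hφ
  by_cases hn : φ n = 0
  · have hsum : ∑ i, p i * normSq (ψ i n) = 0 := by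
      rw [← (Finset.sum_eq_sum_iff_of_le fun m _ => hle m).mp htotal n (Finset.mem_univ n), hn,
        normSq_eq_zero]
    have hzero (i : ι) : p i • schmidtVector (ψ i n) = 0 := by
      rw [← normSq_smul_schmidtVector_normalize, smul_smul,
        (Finset.sum_eq_zero_iff_of_nonneg fun i _ => mul_nonneg (hp i) (normSq_nonneg _)).mp hsum i
          (Finset.mem_univ i), zero_smul]
    have hφn : schmidtVector (φ n) = 0 := by
      rw [← normSq_smul_schmidtVector_normalize, normSq_eq_zero.mpr hn, zero_smul]
    simp only [ssrSchmidtVector, hzero, hφn, Finset.sum_const_zero]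
    exact ⟨fun _ _ => le_rfl, rfl⟩
  · exact hmaj n hn

end Sectors

section Steering

lemma exists_linearIsometry_forall_apply_eq {𝕜 E F : Type*} [RCLike 𝕜] [AddCommGroup E] [Module 𝕜 E]
    [NormedAddCommGroup F] [InnerProductSpace 𝕜 F] [FiniteDimensional 𝕜 F] {T S : E →ₗ[𝕜] F}
    (h : ∀ v, ‖T v‖ = ‖S v‖) : ∃ L : F →ₗᵢ[𝕜] F, ∀ v, L (T v) = S v := by
  have hker : LinearMap.ker T ≤ LinearMap.ker S := fun v hv => by
    rw [LinearMap.mem_ker, ← norm_eq_zero] at hv ⊢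
    rw [← h, hv]
  let L₀ : LinearMap.range T →ₗ[𝕜] F :=
    (LinearMap.ker T).liftQ S hker ∘ₗ T.quotKerEquivRange.symm.toLinearMap
  have hL₀ (v : E) : L₀ ⟨T v, LinearMap.mem_range_self T v⟩ = S v := by
    simp only [L₀, LinearMap.comp_apply, LinearEquiv.coe_coe,
      LinearMap.quotKerEquivRange_symm_apply_image, Submodule.mkQ_apply, Submodule.liftQ_apply]
  let L : LinearMap.range T →ₗᵢ[𝕜] F := ⟨L₀, by
    rintro ⟨_, v, rfl⟩
    exact (congrArg norm (hL₀ v)).trans (h v).symm⟩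
  exact ⟨L.extend, fun v => (L.extend_apply ⟨T v, LinearMap.mem_range_self T v⟩).trans (hL₀ v)⟩

lemma exists_unitary_mul_eq {α γ : Type*} [Finite α] [Fintype γ] [DecidableEq γ]
    {x y : Matrix α γ ℂ} (h : x * xᴴ = y * yᴴ) :
    ∃ U : Matrix γ γ ℂ, star U * U = 1 ∧ x * U = y := by
  classical
  cases nonempty_fintype α
  let T (z : Matrix α γ ℂ) : (α → ℂ) →ₗ[ℂ] EuclideanSpace ℂ γ :=
    (WithLp.linearEquiv 2 ℂ (γ → ℂ)).symm.toLinearMap ∘ₗ zᴴ.mulVecLin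
  have hinner (z : Matrix α γ ℂ) (v : α → ℂ) :
      inner ℂ (T z v) (T z v) = star v ⬝ᵥ (z * zᴴ) *ᵥ v := by
    rw [EuclideanSpace.inner_eq_star_dotProduct, dotProduct_comm]
    change star (zᴴ *ᵥ v) ⬝ᵥ zᴴ *ᵥ v = _
    rw [Matrix.star_mulVec, Matrix.conjTranspose_conjTranspose, ← Matrix.dotProduct_mulVec,
      Matrix.mulVec_mulVec]
  have hnorm (v : α → ℂ) : ‖T x v‖ = ‖T y v‖ := by
    rw [@norm_eq_sqrt_re_inner ℂ, @norm_eq_sqrt_re_inner ℂ, hinner, hinner, h]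
  obtain ⟨L, hL⟩ := exists_linearIsometry_forall_apply_eq hnorm
  let e := Matrix.toEuclideanCLM (n := γ) (𝕜 := ℂ)
  obtain ⟨W, hW : e W = L.toContinuousLinearMap⟩ := e.surjective _
  have hWW : star W * W = 1 := EquivLike.injective e <| by
    rw [map_mul, map_star, map_one, hW]
    exact (ContinuousLinearMap.norm_map_iff_adjoint_comp_self _).mp L.norm_map
  have hWx : W * xᴴ = yᴴ := Matrix.mulVec_injective <| funext fun v => by
    rw [← Matrix.mulVec_mulVec]
    have happly : e W (T x v) = T y v := by
      rw [hW]
      exact hL v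
    exact congrArg WithLp.ofLp happly
  refine ⟨star W, by rw [star_star, mul_eq_one_comm.mp hWW], ?_⟩
  rw [← Matrix.conjTranspose_inj, Matrix.conjTranspose_mul, Matrix.star_eq_conjTranspose,
    Matrix.conjTranspose_conjTranspose, hWx]

lemma sqrt_smul_mul_conjTranspose {α β : Type*} [Fintype β] {q : ℝ} (hq : 0 ≤ q)
    (x : Matrix α β ℂ) :
    ((Real.sqrt q : ℂ) • x) * ((Real.sqrt q : ℂ) • x)ᴴ = (q : ℂ) • (x * xᴴ) := by
  rw [Matrix.conjTranspose_smul, Matrix.smul_mul, Matrix.mul_smul, smul_smul, RCLike.star_def,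
    Complex.conj_ofReal, ← Complex.ofReal_mul, Real.mul_self_sqrt hq]

/-- The Hughston–Jozsa–Wootters theorem. The block rows `(x, 0, …, 0)` and `(z j)`, indexed by
`J × β`, have the same Gram matrix; the first block row of a unitary relating them is the
measurement. -/
theorem exists_measurement_actB_eq {α β J : Type*} [Finite α] [Fintype β] [DecidableEq β]
    [Fintype J] [Nonempty J] {x : Matrix α β ℂ} {z : J → Matrix α β ℂ}
    (h : x * xᴴ = ∑ j, z j * (z j)ᴴ) :
    ∃ N : J → Matrix β β ℂ, ∑ j, star (N j) * N j = 1 ∧ ∀ j, actB (N j) x = z j := by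
  classical
  let j₀ : J := Classical.arbitrary J
  let x' : Matrix α (J × β) ℂ := Matrix.of fun a jb => if jb.1 = j₀ then x a jb.2 else 0
  let z' : Matrix α (J × β) ℂ := Matrix.of fun a jb => z jb.1 a jb.2
  have hgram : x' * x'ᴴ = z' * z'ᴴ := by
    ext a a'
    simpa [x', z', Matrix.mul_apply, Matrix.sum_apply, Fintype.sum_prod_type, ite_mul,
      Finset.sum_ite_irrel] using congrFun₂ h a a'
  obtain ⟨U, hU, hxU⟩ := exists_unitary_mul_eq hgram
  refine ⟨fun j => Matrix.of fun b' b => U (j₀, b) (j, b'), ?_, fun j => ?_⟩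
  · have hUU : U * star U = 1 := mul_eq_one_comm.mp hU
    ext b b'
    simpa [Matrix.mul_apply, Matrix.sum_apply, Fintype.sum_prod_type, Matrix.one_apply, mul_comm,
      eq_comm] using congrFun₂ hUU (j₀, b') (j₀, b)
  · ext a b
    simpa [x', z', Matrix.mul_apply, Fintype.sum_prod_type, ite_mul, actB, Finset.sum_ite_irrel]
      using congrFun₂ hxU a (j, b)

variable {α β : Type*} [Fintype α] [DecidableEq α] [Fintype β]

lemma exists_unitary_conj_eq (x y : Matrix α β ℂ) (σ : Equiv.Perm (Fin (Fintype.card α))) :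
    ∃ G : Matrix α α ℂ, star G * G = 1 ∧ G * (y * yᴴ) * star G =
      schmidtBasis x * Matrix.diagonal (fun l => (schmidtVector y (σ l) : ℂ)) *
        (schmidtBasis x)ᴴ := by
  let V := schmidtBasis x
  let W := (schmidtBasis y).submatrix id σ
  have hV : Vᴴ * V = 1 := conjTranspose_schmidtBasis_mul_self x
  have hW : Wᴴ * W = 1 := by
    rw [Matrix.conjTranspose_submatrix, ← Matrix.submatrix_mul _ _ _ _ _ Function.bijective_id,
      conjTranspose_schmidtBasis_mul_self, Matrix.submatrix_one_equiv]
  have hW' : W * Wᴴ = 1 := by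
    rw [Matrix.conjTranspose_submatrix, Matrix.submatrix_mul_equiv, Matrix.submatrix_id_id,
      schmidtBasis_mul_conjTranspose_self]
  have hy : y * yᴴ = W * Matrix.diagonal (fun l => (schmidtVector y (σ l) : ℂ)) * Wᴴ := by
    rw [mul_conjTranspose_self_eq_schmidt, Matrix.conjTranspose_submatrix,
      show (fun l => (schmidtVector y (σ l) : ℂ)) = (fun l => (schmidtVector y l : ℂ)) ∘ σ from rfl,
      ← Matrix.submatrix_diagonal_equiv, Matrix.submatrix_mul_equiv, Matrix.submatrix_mul_equiv,
      Matrix.submatrix_id_id]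
  have hG : star (V * Wᴴ) = W * Vᴴ := by
    rw [Matrix.star_eq_conjTranspose, Matrix.conjTranspose_mul, Matrix.conjTranspose_conjTranspose]
  refine ⟨V * Wᴴ, ?_, ?_⟩
  · calc star (V * Wᴴ) * (V * Wᴴ) = W * (Vᴴ * V) * Wᴴ := by simp only [hG, Matrix.mul_assoc]
      _ = 1 := by rw [hV, Matrix.mul_one, hW']
  · set D := Matrix.diagonal fun l => (schmidtVector y (σ l) : ℂ)
    calc V * Wᴴ * (y * yᴴ) * star (V * Wᴴ) = V * (Wᴴ * W * D * (Wᴴ * W)) * Vᴴ := by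
          simp only [hG, hy, Matrix.mul_assoc]
      _ = V * D * Vᴴ := by rw [hW, Matrix.one_mul, Matrix.mul_one]

theorem exists_actA_actB_eq_smul [DecidableEq β] {J : Type*} [Fintype J] [Nonempty J]
    {x : Matrix α β ℂ} {y : J → Matrix α β ℂ} {q : J → ℝ}
    {σ : J → Equiv.Perm (Fin (Fintype.card α))} (hq : ∀ j, 0 ≤ q j)
    (h : ∀ l, schmidtVector x l = ∑ j, q j * schmidtVector (y j) (σ j l)) :
    ∃ (N : J → Matrix β β ℂ) (U : J → Matrix α α ℂ), ∑ j, star (N j) * N j = 1 ∧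
      (∀ j, star (U j) * U j = 1) ∧
      ∀ j, actA (U j) (actB (N j) x) = (Real.sqrt (q j) : ℂ) • y j := by
  choose G hG hGy using fun j => exists_unitary_conj_eq x (y j) (σ j)
  have hdiag : Matrix.diagonal (fun l => (schmidtVector x l : ℂ)) =
      ∑ j, (q j : ℂ) • Matrix.diagonal fun l => (schmidtVector (y j) (σ j l) : ℂ) := by
    simp only [h, Complex.ofReal_sum, Complex.ofReal_mul]
    ext a b
    simp [Matrix.diagonal_apply, Matrix.sum_apply, Finset.sum_ite_irrel]
  have hx : x * xᴴ = ∑ j, ((Real.sqrt (q j) : ℂ) • (G j * y j)) *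
      ((Real.sqrt (q j) : ℂ) • (G j * y j))ᴴ := by
    rw [mul_conjTranspose_self_eq_schmidt, hdiag, Matrix.mul_sum, Matrix.sum_mul]
    refine Finset.sum_congr rfl fun j _ => ?_
    rw [sqrt_smul_mul_conjTranspose (hq j), Matrix.mul_smul, Matrix.smul_mul, ← hGy,
      Matrix.star_eq_conjTranspose, Matrix.conjTranspose_mul]
    simp only [Matrix.mul_assoc]
  obtain ⟨N, hN, hNx⟩ := exists_measurement_actB_eq hx
  refine ⟨N, fun j => star (G j), hN, fun j => ?_, fun j => ?_⟩
  · rw [star_star, mul_eq_one_comm.mp (hG j)]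
  · rw [hNx, actA, Matrix.mul_smul, ← Matrix.mul_assoc, hG, Matrix.one_mul]

end Steering

section Construction

namespace Protocol

variable {R S ι J V : Type*} [Ring R] [StarRing R] [Ring S] [StarRing S] [Fintype J]

/-- The two-round protocol in which Bob measures with Kraus operators `N j`, Alice applies the
isometry `U j`, a measurement with a single result, and the branch is declared to be outcome
`o j`. -/
noncomputable def bobThenAlice (N : J → S) (hN : ∑ j, star (N j) * N j = 1) (U : J → R)
    (hU : ∀ j, star (U j) * U j = 1) (o : J → ι) : Protocol R S ι :=
  let e := Fintype.equivFin J
  .bob _ (fun l => N (e.symm l)) ((e.symm.sum_comp fun j => star (N j) * N j).trans hN) fun l =>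
    .alice 1 (fun _ => U (e.symm l)) ((Fin.sum_univ_one _).trans (hU _)) fun _ =>
      .done (o (e.symm l))

variable {N : J → S} {hN : ∑ j, star (N j) * N j = 1} {U : J → R}
  {hU : ∀ j, star (U j) * U j = 1} {o : J → ι} {actA : R → V → V} {actB : S → V → V} {χ : V}

lemma bobThenAlice_yields [SMul ℂ V] {ψ : ι → V}
    (h : ∀ j, ∃ c : ℂ, actA (U j) (actB (N j) χ) = c • ψ (o j)) :
    (bobThenAlice N hN U hU o).Yields actA actB ψ χ :=
  fun _ _ => h _

lemma prob_bobThenAlice [DecidableEq ι] {normSq : V → ℝ} (i : ι) :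
    (bobThenAlice N hN U hU o).prob actA actB normSq i χ =
      ∑ j with o j = i, normSq (actA (U j) (actB (N j) χ)) := by
  rw [Finset.sum_filter, ← (Fintype.equivFin J).symm.sum_comp]
  simp only [bobThenAlice, Protocol.prob, Fin.sum_univ_one]

end Protocol

lemma exists_pi_extension {ν μ : Type*} {C : μ → Type*} {P : ∀ m, C m → Prop}
    {f : ν → μ} (hf : Function.Injective f) {u : ∀ n, C (f n)} (hu : ∀ n, P _ (u n))
    (hP : ∀ m, ∃ z, P m z) :
    ∃ z : ∀ m, C m, (∀ m, P m (z m)) ∧ ∀ n, z (f n) = u n := by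
  have key (m : μ) : ∃ z : C m, P m z ∧ ∀ n (h : f n = m), z = h ▸ u n := by
    by_cases hm : ∃ n, f n = m
    · obtain ⟨n, rfl⟩ := hm
      refine ⟨u n, hu n, fun n' h => ?_⟩
      obtain rfl := hf h
      rfl
    · obtain ⟨z, hz⟩ := hP m
      exact ⟨z, hz, fun n h => (hm ⟨n, h⟩).elim⟩
  choose z hz using key
  exact ⟨z, fun m => (hz m).1, fun n => (hz (f n)).2 n rfl⟩

variable {A B : ℕ → Type*} [∀ n, Fintype (A n)] [∀ n, DecidableEq (A n)]
  [∀ n, Fintype (B n)] [∀ n, DecidableEq (B n)] {N : ℕ}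

theorem State.exists_actA_actB_eq_smul {J : Type*} [Fintype J] [Nonempty J] {φ : State A B N}
    {ψ : J → State A B N} {q : J → ℝ}
    {σ : J → ∀ n : Fin (N + 1), Equiv.Perm (Fin (Fintype.card (A n)))} (hq : ∀ j, 0 ≤ q j)
    (h : ∀ n l, ssrSchmidtVector φ n l = ∑ j, q j * ssrSchmidtVector (ψ j) n (σ j n l)) :
    ∃ (M : J → LocalOp B) (U : J → LocalOp A), ∑ j, star (M j) * M j = 1 ∧
      (∀ j, star (U j) * U j = 1) ∧
      ∀ j, State.actA (U j) (State.actB (M j) φ) = (Real.sqrt (q j) : ℂ) • ψ j := by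
  classical
  have hsub : Function.Injective fun n : Fin (N + 1) => N - n.val := fun a b hab => by
    ext
    simp only at hab
    omega
  choose M' U' hM' hU' hMU using fun n => SSR.exists_actA_actB_eq_smul hq (h n)
  obtain ⟨M, hM, hMeq⟩ := exists_pi_extension (C := fun m => J → Matrix (B m) (B m) ℂ)
    (P := fun _ z => ∑ j, star (z j) * z j = 1) hsub hM'
    fun _ => ⟨Pi.single (Classical.arbitrary J) 1, by simp [Pi.single_apply]⟩
  obtain ⟨U, hU, hUeq⟩ := exists_pi_extension (C := fun m => J → Matrix (A m) (A m) ℂ)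
    (P := fun _ z => ∀ j, star (z j) * z j = 1) Fin.val_injective hU' fun _ => ⟨1, by simp⟩
  refine ⟨fun j m => M m j, fun j m => U m j, ?_, fun j => funext fun m => hU m j,
    fun j => funext fun n => ?_⟩
  · funext m
    rw [Finset.sum_apply]
    exact hM m
  · simp only [State.actA, State.actB, hMeq, hUeq, hMU, Pi.smul_apply]

theorem ssrConverts_of_majorizedBy {ι : Type*} [Fintype ι] {φ : State A B N} {p : ι → ℝ}
    {ψ : ι → State A B N} (hp : ∀ i, 0 ≤ p i) (hp1 : ∑ i, p i = 1) (hψ : ∀ i, (ψ i).normSq = 1)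
    (h : ∀ n, MajorizedBy (ssrSchmidtVector φ n) (∑ i, p i • ssrSchmidtVector (ψ i) n)) :
    SSRConverts φ p ψ := by
  classical
  obtain ⟨κ, _, t, σ, ht, ht1, hσ⟩ :=
    exists_common_weights_of_majorizedBy h fun n => schmidtVector_antitone (φ n)
  have hq (j : ι × κ) : 0 ≤ p j.1 * t j.2 := mul_nonneg (hp _) (ht _)
  have hmarginal (i : ι) : ∑ j : ι × κ with j.1 = i, p j.1 * t j.2 = p i := by
    simp only [Finset.sum_filter, Fintype.sum_prod_type, Finset.sum_ite_irrel, ← Finset.mul_sum,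
      ht1, mul_one, Finset.sum_const_zero, Finset.sum_ite_eq', Finset.mem_univ, if_true]
  have hdecomp (n l) : ssrSchmidtVector φ n l =
      ∑ j : ι × κ, (p j.1 * t j.2) * ssrSchmidtVector (ψ j.1) n (σ j.2 n l) := by
    rw [Fintype.sum_prod_type_right, hσ]
    simp only [Finset.sum_apply, Pi.smul_apply, smul_eq_mul, Finset.mul_sum, mul_left_comm,
      mul_assoc]
  have : Nonempty ι := not_isEmpty_iff.mp fun _ => by simp at hp1
  have : Nonempty κ := not_isEmpty_iff.mp fun _ => by simp at ht1
  obtain ⟨M, U, hM, hU, hMU⟩ := State.exists_actA_actB_eq_smul hq hdecomp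
  refine ⟨Protocol.bobThenAlice M hM U hU Prod.fst,
    Protocol.bobThenAlice_yields fun j => ⟨_, hMU j⟩, fun i => ?_⟩
  simp only [Protocol.prob_bobThenAlice, hMU, State.normSq_smul, norm_ofReal_sqrt_sq (hq _), hψ,
    mul_one, hmarginal]

end Construction

end SSR

theorem theorem1 {A B : ℕ → Type*} [∀ n, Fintype (A n)] [∀ n, DecidableEq (A n)]
    [∀ n, Fintype (B n)] [∀ n, DecidableEq (B n)] {N : ℕ} {ι : Type*} [Fintype ι]
    (φ : SSR.State A B N) (hφ : φ.normSq = 1)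
    (p : ι → ℝ) (hp : ∀ i, 0 ≤ p i) (hp1 : ∑ i, p i = 1)
    (ψ : ι → SSR.State A B N) (hψ : ∀ i, (ψ i).normSq = 1) :
    (SSR.SSRConverts φ p ψ ↔
      ∀ n : Fin (N + 1), SSR.MajorizedBy (SSR.ssrSchmidtVector φ n)
        (∑ i, p i • SSR.ssrSchmidtVector (ψ i) n)) ∧
    (SSR.SSRConverts φ p ψ ↔
      ∀ n : Fin (N + 1), φ n ≠ 0 →
        SSR.LOCCConverts (SSR.normalize (φ n))
          (fun i => p i * SSR.normSq (ψ i n) / SSR.normSq (φ n))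
          (fun i => SSR.normalize (ψ i n))) := by
  have hLOCC (h : SSR.SSRConverts φ p ψ) := h.loccConverts hψ
  have hMaj := SSR.majorizedBy_of_loccConverts hφ hp hp1 hψ
  have hSSR := SSR.ssrConverts_of_majorizedBy (φ := φ) hp hp1 hψ
  exact ⟨⟨fun h => hMaj fun n _ => hLOCC h n, hSSR⟩, fun h n _ => hLOCC h n, fun h => hSSR (hMaj h)⟩
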